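/- For a string $s = s[1]\cdots s[n]$, a non-empty substring $s[i..j]$ (identified with the pair $(i,j)$) is a \emph{closed repeat} if it has a next occurrence $s[i'..j']=s[i..j]$, i.e. an occurrence with $i'>i$ and $i'$ smallest possible, and this occurrence satisfies ($i=1$ or $s[i-1]\neq s[i'-1]$) and ($j'=n$ or $s[j+1]\neq s[j'+1]$). An algorithm over a general ordered alphabet is a deterministic algorithm whose only access to the letters of the input is to compare the letters at two positions, learning in one time step whether the first is smaller than, equal to or larger than the second. \textbf{Theorem 3.} For every $\varepsilon>0$ there are constants $c,C>0$ and $n_0$, depending only on $\varepsilon$, such that the following holds for every $n\ge n_0$ and every finite totally ordered alphabet $\Sigma$ of size $\sigma\ge n^{\varepsilon}$. Let $A$ be an algorithm over the general ordered alphabet that computes the set of all closed repeats of each string $s\in\Sigma^n$ (or merely of each $s\in\Sigma^n$ in which at least $\min(\sigma,\lfloor n/2\rfloor)$ distinct letters occur). Then there is a string $s\in\Sigma^n$, also containing at least $\min(\sigma,\lfloor n/2\rfloor)$ distinct letters, that has at most $Cn$ closed repeats and on which $A$ makes at least $c\,n\log_2 n$ letter comparisons, and hence spends at least $c\,n\log_2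 n$ time. -/

import Mathlib

namespace ClosedRepeats

/-- The letter of `s` at position `k` (positions are `0, …, n - 1`), and `none` outside the string. -/
def letterAt {n : ℕ} {α : Type} (s : Fin n → α) (k : ℕ) : Option α :=
  if h : k < n then some (s ⟨k, h⟩) else none

/-- The substring `s[i..j]` occurs in `s` at position `p`
(for `k ≤ j - i` the left-hand side is a genuine letter, so the occurrence lies inside `s`). -/
def OccursAt {n : ℕ} {α : Type} (s : Fin n → α) (i j p : Fin n) : Prop :=
  ∀ k ≤ (j : ℕ) - i, letterAt s (i + k) = letterAt s (p + k)

/-- `p` is the position of the next occurrence of the non-empty substring `s[i..j]`. -/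
def IsNextOcc {n : ℕ} {α : Type} (s : Fin n → α) (i j p : Fin n) : Prop :=
  i ≤ j ∧ i < p ∧ OccursAt s i j p ∧ ∀ q : Fin n, i < q → q < p → ¬ OccursAt s i j q

/-- `s[i..j]` is a right closed repeat: its next occurrence `s[p..j']`, `j' = p + (j - i)`, has
`s[j + 1] ≠ s[j' + 1]` or ends at the last position of `s`. -/
def IsRightClosedRepeat {n : ℕ} {α : Type} (s : Fin n → α) (i j : Fin n) : Prop :=
  ∃ p : Fin n, IsNextOcc s i j p ∧
    (letterAt s ((j : ℕ) + 1) ≠ letterAt s ((p : ℕ) + ((j : ℕ) - i) + 1) ∨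
      (p : ℕ) + ((j : ℕ) - i) + 1 = n)

/-- `s[i..j]` is a left closed repeat: its next occurrence `s[p..j']` has
`s[i - 1] ≠ s[p - 1]`, or `s[i..j]` starts at the first position of `s`. -/
def IsLeftClosedRepeat {n : ℕ} {α : Type} (s : Fin n → α) (i j : Fin n) : Prop :=
  ∃ p : Fin n, IsNextOcc s i j p ∧
    (letterAt s ((i : ℕ) - 1) ≠ letterAt s ((p : ℕ) - 1) ∨ (i : ℕ) = 0)

/-- `s[i..j]` is a closed repeat: both left and right closed. -/
def IsClosedRepeat {n : ℕ} {α : Type} (s : Fin n → α) (i j : Fin n) : Prop :=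
  IsLeftClosedRepeat s i j ∧ IsRightClosedRepeat s i j

open Classical in
/-- The set of all closed repeats of `s`, each given by its first and its last position. -/
noncomputable def closedRepeats {n : ℕ} {α : Type} (s : Fin n → α) : Finset (Fin n × Fin n) :=
  Finset.univ.filter fun x => IsClosedRepeat s x.1 x.2

/-- The number of distinct letters that occur in `s`. -/
noncomputable def numLetters {n : ℕ} {α : Type} (s : Fin n → α) : ℕ :=
  (Set.range s).ncard

/-- One instruction of an algorithm on strings of length `n` with states `Q`. -/
inductive Instr (n : ℕ) (Q : Type) : Type
  /-- compare the letters at positions `i` and `j` and branch on their relative order -/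
  | test (i j : Fin n) (next : Ordering → Q) : Instr n Q
  /-- any other elementary operation; it does not look at the letters -/
  | work (next : Q) : Instr n Q
  /-- stop and report a set of substrings (first and last positions) -/
  | halt (out : Finset (Fin n × Fin n)) : Instr n Q

/-- An algorithm on strings of length `n` over a general ordered alphabet: an arbitrary
deterministic machine that can access the letters only by order comparisons.
It may depend on `n` and on the alphabet, and it need not halt. -/
structure Algorithm (n : ℕ) where
  State : Type
  start : State
  instr : State → Instr n State

/-- `A.HaltsWith s q k t out`: on input `s`, from state `q`, the algorithm halts with output `out`
after exactly `t` steps, exactly `k` of which are comparisons of letters. -/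
inductive Algorithm.HaltsWith {n : ℕ} {α : Type} [LinearOrder α] (A : Algorithm n) (s : Fin n → α) :
    A.State → ℕ → ℕ → Finset (Fin n × Fin n) → Prop
  | halt {q : A.State} {out : Finset (Fin n × Fin n)} (h : A.instr q = Instr.halt out) :
      A.HaltsWith s q 0 0 out
  | work {q q' : A.State} {k t : ℕ} {out : Finset (Fin n × Fin n)}
      (h : A.instr q = Instr.work q') (hq : A.HaltsWith s q' k t out) :
      A.HaltsWith s q k (t + 1) out
  | test {q : A.State} {i j : Fin n} {next : Ordering → A.State} {k t : ℕ}
      {out : Finset (Fin n × Fin n)} (h : A.instr q = Instr.test i j next)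
      (hq : A.HaltsWith s (next (cmp (s i) (s j))) k t out) :
      A.HaltsWith s q (k + 1) (t + 1) out

/-- On input `s`, the algorithm halts and reports exactly the closed repeats of `s`,
in time `t` and with `k` comparisons. -/
def Algorithm.ComputesWith {n : ℕ} {α : Type} [LinearOrder α] (A : Algorithm n) (s : Fin n → α)
    (k t : ℕ) : Prop :=
  A.HaltsWith s A.start k t (closedRepeats s)

end ClosedRepeats

namespace ClosedRepeats

/-! The proof is an information-theoretic bound with a fooling input. A hard string has `K` blocks.
Each block lists the data letters `0, …, b - 1` and then a permutation of them, every letter being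
preceded by the base-`b` digits of the block number. Such a cycle recurs only inside its own block,
so the closed repeats reveal which letters the second half contains (`exists_isClosedRepeat_iff`,
`hardWord_occursAt_iff`).

If two families of permutations gave the same comparison results, their pointwise maximum would give
them too (`Algorithm.Trace.max`), hence the same output. Every letter would then be a value of the
maximum of the two permutations in each block, which forces them to be equal
(`perm_eq_of_max_surjective`). So the `b! ^ K` families have distinct traces, and some trace has
length about `K * log b!`, of order `n * log n` when `b` is about `n ^ (1 / k)` and `K` about `n /
(8 * b * (k + 1))`.

The output stays linear because each letter occurs at most twice per block: the start of a substring
longer than two cycles fixes its next occurrence (`hardWord_nextOcc_unique`), so at most one long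
closed repeat starts at each position (`card_closedRepeats_le`). -/

/-- `A.Trace s q w out`: on input `s`, from state `q`, the algorithm halts with output `out`
after having seen the comparison results `w`. -/
inductive Algorithm.Trace {n : ℕ} {α : Type} [LinearOrder α] (A : Algorithm n) (s : Fin n → α) :
    A.State → List Ordering → Finset (Fin n × Fin n) → Prop
  | halt {q : A.State} {out : Finset (Fin n × Fin n)} (h : A.instr q = Instr.halt out) :
      A.Trace s q [] out
  | work {q q' : A.State} {w : List Ordering} {out : Finset (Fin n × Fin n)}
      (h : A.instr q = Instr.work q') (hq : A.Trace s q' w out) : A.Trace s q w out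
  | test {q : A.State} {i j : Fin n} {next : Ordering → A.State} {w : List Ordering}
      {out : Finset (Fin n × Fin n)} (h : A.instr q = Instr.test i j next)
      (hq : A.Trace s (next (cmp (s i) (s j))) w out) :
      A.Trace s q (cmp (s i) (s j) :: w) out

/-! ### Comparison traces and their closure under pointwise maximum. -/

section Machine

variable {n : ℕ} {α : Type} [LinearOrder α] {A : Algorithm n}

theorem Algorithm.HaltsWith.exists_trace {s : Fin n → α} {q : A.State} {k t : ℕ}
    {out : Finset (Fin n × Fin n)} (h : A.HaltsWith s q k t out) :
    ∃ w : List Ordering, w.length = k ∧ A.Trace s q w out := by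
  induction h with
  | halt h => exact ⟨[], rfl, .halt h⟩
  | work h _ ih =>
    obtain ⟨w, hw, hT⟩ := ih
    exact ⟨w, hw, .work h hT⟩
  | test h _ ih =>
    obtain ⟨w, hw, hT⟩ := ih
    exact ⟨_ :: w, by simp [hw], .test h hT⟩

theorem Algorithm.HaltsWith.comparisons_le_time {s : Fin n → α} {q : A.State} {k t : ℕ}
    {out : Finset (Fin n × Fin n)} (h : A.HaltsWith s q k t out) : k ≤ t := by
  induction h <;> omega

theorem Algorithm.Trace.out_eq {s : Fin n → α} {q : A.State} {k t : ℕ} {w : List Ordering}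
    {out out' : Finset (Fin n × Fin n)} (h : A.Trace s q w out)
    (h' : A.HaltsWith s q k t out') : out = out' := by
  induction h generalizing k t with
  | halt h =>
    cases h' with
    | halt g => rw [h] at g; exact (Instr.halt.inj g)
    | work g _ => rw [h] at g; cases g
    | test g _ => rw [h] at g; cases g
  | work h _ ih =>
    cases h' with
    | halt g => rw [h] at g; cases g
    | work g hq => rw [h] at g; cases g; exact ih hq
    | test g _ => rw [h] at g; cases g
  | test h _ ih =>
    cases h' with
    | halt g => rw [h] at g; cases g
    | work g _ => rw [h] at g; cases g
    | test g hq => rw [h] at g; cases g; exact ih hq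

theorem cmp_max_max {a b a' b' : α} (h : cmp a b = cmp a' b') :
    cmp (max a a') (max b b') = cmp a b := by
  rcases lt_trichotomy a b with hab | hab | hab
  · have h1 := cmp_eq_lt_iff a b |>.2 hab
    rw [h1] at h ⊢
    exact (cmp_eq_lt_iff _ _).2 (max_lt_max hab ((cmp_eq_lt_iff _ _).1 h.symm))
  · have h1 := cmp_eq_eq_iff a b |>.2 hab
    rw [h1] at h ⊢
    rw [hab, (cmp_eq_eq_iff _ _).1 h.symm]
    simp
  · have h1 := cmp_eq_gt_iff a b |>.2 hab
    rw [h1] at h ⊢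
    exact (cmp_eq_gt_iff _ _).2 (max_lt_max hab ((cmp_eq_gt_iff _ _).1 h.symm))

/-- Inputs that follow the same path follow it together with their pointwise maximum. -/
theorem Algorithm.Trace.max {s s' : Fin n → α} {q : A.State} {w : List Ordering}
    {out out' : Finset (Fin n × Fin n)} (h : A.Trace s q w out) (h' : A.Trace s' q w out') :
    A.Trace (fun i => max (s i) (s' i)) q w out := by
  induction h with
  | halt h => exact .halt h
  | work h _ ih =>
    cases h' with
    | halt g => rw [h] at g; cases g
    | work g hq => rw [h] at g; cases g; exact .work h (ih hq)
    | test g _ => rw [h] at g; cases g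
  | @test q i j next w out h hq ih =>
    generalize hv : cmp (s i) (s j) :: w = v at h'
    cases h' with
    | halt g => cases hv
    | work g hq => rw [h] at g; cases g
    | test g hq' =>
      rw [h] at g
      cases g
      obtain ⟨hc, rfl⟩ := List.cons.inj hv
      have hm := cmp_max_max hc
      rw [← hc] at hq' ⊢
      rw [← hm]
      refine .test h ?_
      simp only [hm]
      exact ih hq'

/-- A ternary decision tree that separates the elements of a family is deep on one of them. -/
theorem exists_card_le_three_pow {ι : Type*} [Fintype ι] [Nonempty ι] (w : ι → List Ordering)
    (hw : Function.Injective w) : ∃ x, Fintype.card ι ≤ 3 ^ ((w x).length + 1) := by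
  obtain ⟨x, hx⟩ := Finite.exists_max fun x => (w x).length
  refine ⟨x, ?_⟩
  set D := (w x).length
  let f : ι → Σ i : Fin (D + 1), List.Vector Ordering i :=
    fun y => ⟨⟨(w y).length, Nat.lt_succ_of_le (hx y)⟩, ⟨w y, rfl⟩⟩
  have hf : Function.Injective f := by
    intro y z h
    have key : ∀ u v : Σ i : Fin (D + 1), List.Vector Ordering i, u = v → u.2.1 = v.2.1 := by
      rintro u v rfl; rfl
    exact hw (key _ _ h)
  have h1 := Fintype.card_le_of_injective f hf
  have h3 : Fintype.card Ordering = 3 := rfl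
  simp only [Fintype.card_sigma, card_vector, h3] at h1
  refine h1.trans ?_
  rw [Fin.sum_univ_eq_sum_range (fun i => 3 ^ i)]
  exact (Nat.geomSum_lt (by norm_num) (by simp)).le

end Machine

/-! ### Closed repeats of an arbitrary string. -/

section Repeats

variable {n : ℕ} {α : Type} {s : Fin n → α} {i j p : Fin n}

theorem letterAt_of_lt (s : Fin n → α) {k : ℕ} (h : k < n) : letterAt s k = some (s ⟨k, h⟩) := by
  simp [letterAt, h]

theorem lt_of_letterAt_eq {k l : ℕ} (h : letterAt s k = letterAt s l) (hk : k < n) : l < n := by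
  by_contra hl
  simp [letterAt, hk, hl] at h

theorem OccursAt.end_lt (h : OccursAt s i j p) (hij : i ≤ j) : (p : ℕ) + (j - i) < n := by
  have hij' : (i : ℕ) ≤ j := hij
  exact lt_of_letterAt_eq (h (j - i) le_rfl) (by omega)

theorem exists_isNextOcc (hij : i ≤ j) (hip : i < p) (h : OccursAt s i j p) :
    ∃ q, IsNextOcc s i j q := by
  obtain ⟨q, ⟨h1, h2⟩, h3⟩ := wellFounded_lt.has_min {q | i < q ∧ OccursAt s i j q} ⟨p, hip, h⟩
  exact ⟨q, hij, h1, h2, fun r hr hrq hocc => h3 r ⟨hr, hocc⟩ hrq⟩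

theorem IsNextOcc.extend_left (h : IsNextOcc s i j p) (hi : (i : ℕ) ≠ 0)
    (he : letterAt s ((i : ℕ) - 1) = letterAt s ((p : ℕ) - 1)) :
    IsNextOcc s ⟨i - 1, by omega⟩ j ⟨p - 1, by omega⟩ := by
  obtain ⟨hij, hip, hocc, hmin⟩ := h
  have hij' : (i : ℕ) ≤ j := hij
  have hip' : (i : ℕ) < p := hip
  refine ⟨Fin.le_def.2 (by simp; omega), Fin.lt_def.2 (by simp; omega), ?_, ?_⟩
  · intro k hk
    rcases k with _ | k
    · simpa using he
    · have := hocc k (by simp at hk; omega)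
      convert this using 2 <;> simp <;> omega
  · intro q hq hqp hq'
    have hq1 : (i : ℕ) - 1 < q := hq
    have hq2 : (q : ℕ) < p - 1 := hqp
    refine hmin ⟨q + 1, by omega⟩ (Fin.lt_def.2 (by simp; omega)) (Fin.lt_def.2 (by simp; omega)) ?_
    intro k hk
    have := hq' (k + 1) (by simp; omega)
    convert this using 2 <;> simp <;> omega

theorem IsNextOcc.extend_right (h : IsNextOcc s i j p) (hj : (j : ℕ) + 1 < n)
    (he : letterAt s ((j : ℕ) + 1) = letterAt s ((p : ℕ) + ((j : ℕ) - i) + 1)) :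
    IsNextOcc s i ⟨j + 1, hj⟩ p := by
  obtain ⟨hij, hip, hocc, hmin⟩ := h
  have hij' : (i : ℕ) ≤ j := hij
  refine ⟨Fin.le_def.2 (by simp; omega), hip, ?_, ?_⟩
  · intro k hk
    simp only at hk
    by_cases hk' : k ≤ (j : ℕ) - i
    · exact hocc k hk'
    · obtain rfl : k = j - i + 1 := by omega
      convert he using 2 <;> omega
  · intro q hq hqp hq'
    exact hmin q hq hqp fun k hk => hq' k (by simp; omega)

/-- While a side is not closed, extend both occurrences by one letter there. They remain next
occurrences, since an earlier copy of the longer substring would contain an earlier copy of the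
shorter one. The length is bounded, so this stops. -/
theorem IsNextOcc.exists_isClosedRepeat (h : IsNextOcc s i j p) :
    ∃ i' j', i' ≤ i ∧ j ≤ j' ∧ IsClosedRepeat s i' j' := by
  induction hm : n - (j - i : ℕ) using Nat.strong_induction_on generalizing i j p with
  | _ m ih =>
  have hij : (i : ℕ) ≤ j := h.1
  have hip : (i : ℕ) < p := h.2.1
  have hend := h.2.2.1.end_lt h.1
  by_cases hl : letterAt s ((i : ℕ) - 1) ≠ letterAt s ((p : ℕ) - 1) ∨ (i : ℕ) = 0
  · by_cases hr : letterAt s ((j : ℕ) + 1) ≠ letterAt s ((p : ℕ) + ((j : ℕ) - i) + 1) ∨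
      (p : ℕ) + ((j : ℕ) - i) + 1 = n
    · exact ⟨i, j, le_rfl, le_rfl, ⟨p, h, hl⟩, ⟨p, h, hr⟩⟩
    · push Not at hr
      have hj : (j : ℕ) + 1 < n := by omega
      obtain ⟨i', j', h1, h2, h3⟩ := ih _ (by simp; omega) (h.extend_right hj hr.1) rfl
      exact ⟨i', j', h1, (Fin.le_def.2 (by simp)).trans h2, h3⟩
  · push Not at hl
    obtain ⟨i', j', h1, h2, h3⟩ := ih _ (by simp; omega) (h.extend_left hl.2 hl.1) rfl
    exact ⟨i', j', h1.trans (Fin.le_def.2 (by simp)), h2, h3⟩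

/-- A substring is contained in a closed repeat if and only if it occurs again further right. -/
theorem exists_isClosedRepeat_iff (hij : i ≤ j) :
    (∃ i' j', i' ≤ i ∧ j ≤ j' ∧ IsClosedRepeat s i' j') ↔ ∃ p, i < p ∧ OccursAt s i j p := by
  constructor
  · rintro ⟨i', j', hi, hj, -, p, ⟨hij', hip, hocc, -⟩, -⟩
    have hend := hocc.end_lt hij'
    rw [Fin.le_def] at hi hj hij hij'
    rw [Fin.lt_def] at hip
    refine ⟨⟨p + (i - i'), by omega⟩, Fin.lt_def.2 (by simp; omega), fun k hk => ?_⟩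
    have := hocc (i - i' + k) (by omega)
    convert this using 2
    · omega
    · dsimp only
      omega
  · rintro ⟨p, hip, hocc⟩
    obtain ⟨q, hq⟩ := exists_isNextOcc hij hip hocc
    exact hq.exists_isClosedRepeat

theorem IsRightClosedRepeat.end_le {j' : Fin n} (hj : IsNextOcc s i j p)
    (hr : letterAt s ((j : ℕ) + 1) ≠ letterAt s ((p : ℕ) + ((j : ℕ) - i) + 1) ∨
      (p : ℕ) + ((j : ℕ) - i) + 1 = n) (hj' : IsNextOcc s i j' p) : j' ≤ j := by
  by_contra! hlt
  have h1 : (i : ℕ) ≤ j := hj.1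
  have h2 : (j : ℕ) < j' := hlt
  have hend := hj'.2.2.1.end_lt hj'.1
  rcases hr with hr | hr
  · apply hr
    have := hj'.2.2.1 (j - i + 1) (by omega)
    convert this using 2 <;> omega
  · omega

/-- If the next occurrence of a substring of length more than `l` is determined by its first
position, then there are at most `l + 1` closed repeats per position. -/
theorem card_closedRepeats_le (l : ℕ)
    (hs : ∀ i j j' p p' : Fin n, IsNextOcc s i j p → IsNextOcc s i j' p' →
      (i : ℕ) + l ≤ j → (i : ℕ) + l ≤ j' → p = p') :
    (closedRepeats s).card ≤ n * (l + 1) := by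
  classical
  have key : ∀ i j j' : Fin n, IsClosedRepeat s i j → IsClosedRepeat s i j' →
      (i : ℕ) + l ≤ j → (i : ℕ) + l ≤ j' → j = j' := by
    rintro i j j' ⟨-, p, hp, hr⟩ ⟨-, p', hp', hr'⟩ hl hl'
    obtain rfl := hs i j j' p p' hp hp' hl hl'
    exact le_antisymm (IsRightClosedRepeat.end_le hp' hr' hp) (IsRightClosedRepeat.end_le hp hr hp')
  have hle : ∀ i j : Fin n, IsClosedRepeat s i j → (i : ℕ) ≤ j := fun i j h => by
    obtain ⟨-, p, hp, -⟩ := h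
    exact hp.1
  have : (closedRepeats s).card ≤ (Finset.univ ×ˢ Finset.range (l + 1) : Finset (Fin n × ℕ)).card := by
    -- Cap the length at `l`: shorter repeats are recorded exactly, and by `key` at most one repeat
    -- per start reaches the cap.
    refine Finset.card_le_card_of_injOn (fun x => (x.1, min ((x.2 : ℕ) - x.1) l)) ?_ ?_
    · intro x _
      simp only [Finset.coe_product, Set.mem_prod, Finset.mem_coe, Finset.mem_univ,
        Finset.mem_range, true_and]
      omega
    · rintro ⟨i, j⟩ hx ⟨i', j'⟩ hy hxy
      simp only [closedRepeats, Finset.coe_filter, Finset.mem_univ, true_and,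
        Set.mem_ofPred_eq] at hx hy
      simp only [Prod.mk.injEq] at hxy
      obtain ⟨rfl, hxy⟩ := hxy
      have h1 := hle _ _ hx
      have h2 := hle _ _ hy
      simp only [Prod.mk.injEq, true_and]
      by_cases hj : (i : ℕ) + l ≤ j
      · by_cases hj' : (i : ℕ) + l ≤ j'
        · exact key i j j' hx hy hj hj'
        · apply Fin.ext; omega
      · apply Fin.ext; omega
  simpa using this

end Repeats

/-! ### The hard word over the natural numbers. -/

section Word

/-- The data letter of cycle `c`: each block of `2 * b` cycles lists `0, …, b - 1` and then the
values `y r 0, …, y r (b - 1)`, where `r` is the number of the block. -/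
def cycleData (b : ℕ) (y : ℕ → ℕ → ℕ) (c : ℕ) : ℕ :=
  if c % (2 * b) < b then c % (2 * b) else y (c / (2 * b)) (c % (2 * b) - b)

/-- A cycle consists of the `k` base-`b` digits of its block number and of its data letter;
different positions in a cycle use disjoint ranges of letters. -/
def cycleLetter (k b : ℕ) (y : ℕ → ℕ → ℕ) (c t : ℕ) : ℕ :=
  t * b + if t < k then c / (2 * b) / b ^ t % b else cycleData b y c

/-- `m` cycles, followed by the letters `L - 1, …, 1, 0, 0, …`. -/
def hardWord (k b m L : ℕ) (y : ℕ → ℕ → ℕ) (q : ℕ) : ℕ :=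
  if q < m * (k + 1) then cycleLetter k b y (q / (k + 1)) (q % (k + 1))
  else L - 1 - (q - m * (k + 1))

variable {k b m L : ℕ} {y : ℕ → ℕ → ℕ}

theorem eq_of_digits_eq {b k r r' : ℕ} (hr : r < b ^ k) (hr' : r' < b ^ k)
    (h : ∀ t < k, r / b ^ t % b = r' / b ^ t % b) : r = r' := by
  induction k generalizing r r' with
  | zero => simp at hr hr'; omega
  | succ k ih =>
    have h0 := h 0 (by omega)
    simp only [pow_zero, Nat.div_one] at h0
    have h1 : r / b = r' / b := by
      refine ih (Nat.div_lt_of_lt_mul (by rwa [pow_succ'] at hr))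
        (Nat.div_lt_of_lt_mul (by rwa [pow_succ'] at hr')) fun t ht => ?_
      have := h (t + 1) (by omega)
      simpa only [pow_succ', ← Nat.div_div_eq_div_mul] using this
    rw [← Nat.div_add_mod r b, ← Nat.div_add_mod r' b, h0, h1]

theorem hardWord_cycle {c t : ℕ} (hc : c < m) (ht : t ≤ k) :
    hardWord k b m L y (c * (k + 1) + t) = cycleLetter k b y c t := by
  have h1 : c * (k + 1) + t < m * (k + 1) := by nlinarith
  have h2 : (c * (k + 1) + t) / (k + 1) = c := by
    rw [mul_comm, Nat.mul_add_div (by omega), Nat.div_eq_of_lt (by omega), add_zero]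
  have h3 : (c * (k + 1) + t) % (k + 1) = t := by
    rw [mul_comm, Nat.mul_add_mod, Nat.mod_eq_of_lt (by omega)]
  rw [hardWord, if_pos h1, h2, h3]

theorem hardWord_tail (t : ℕ) : hardWord k b m L y (m * (k + 1) + t) = L - 1 - t := by
  simp [hardWord]

theorem cycleData_lt (hy : ∀ r x, y r x < b) (c : ℕ) : cycleData b y c < b := by
  unfold cycleData
  split_ifs with h
  · exact h
  · exact hy _ _

/-- The letter range reveals the position within the cycle, so matches between cycles must be
aligned. -/
theorem cycleLetter_div (hb : 0 < b) (hy : ∀ r x, y r x < b) (c t : ℕ) :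
    cycleLetter k b y c t / b = t := by
  rw [cycleLetter, mul_comm, Nat.mul_add_div hb]
  split_ifs
  · rw [Nat.div_eq_of_lt (Nat.mod_lt _ hb), add_zero]
  · rw [Nat.div_eq_of_lt (cycleData_lt hy c), add_zero]

theorem hardWord_lt {a : ℕ} (hb : 0 < b) (hy : ∀ r x, y r x < b) (ha : (k + 1) * b ≤ a)
    (hL : L ≤ a) (q : ℕ) : hardWord k b m L y q < a := by
  have : 0 < (k + 1) * b := by positivity
  unfold hardWord
  split_ifs
  · refine lt_of_lt_of_le ?_ ha
    rw [← Nat.div_lt_iff_lt_mul hb, cycleLetter_div hb hy]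
    exact Nat.mod_lt _ (by omega)
  · omega

/-- A cycle only matches cycles of the same block with the same data letter. -/
theorem exists_cycle_of_match {K c q : ℕ} (hk : 0 < k) (hb : 0 < b) (hy : ∀ r x, y r x < b)
    (hK : K ≤ b ^ k) (hm : m = K * (2 * b)) (hc : c < m)
    (h : ∀ t ≤ k, hardWord k b m L y (c * (k + 1) + t) = hardWord k b m L y (q + t)) :
    ∃ c' < m, q = c' * (k + 1) ∧ c' / (2 * b) = c / (2 * b) ∧
      cycleData b y c' = cycleData b y c := by
  have hq : q < m * (k + 1) := by
    -- The tail never increases, while the first two letters of a cycle lie in increasing ranges.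
    by_contra! hq
    obtain ⟨d, rfl⟩ := Nat.exists_eq_add_of_le hq
    have h0 := h 0 (by omega)
    have h1 := h 1 (by omega)
    rw [hardWord_cycle hc (by omega), add_zero, hardWord_tail] at h0
    rw [hardWord_cycle hc (by omega), add_assoc, hardWord_tail] at h1
    have e0 := cycleLetter_div (k := k) hb hy c 0
    have e1 := cycleLetter_div (k := k) hb hy c 1
    have : cycleLetter k b y c 1 / b ≤ cycleLetter k b y c 0 / b :=
      Nat.div_le_div_right (by omega)
    omega
  have hmod : q % (k + 1) = 0 := by
    have h0 := h 0 (by omega)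
    rw [hardWord_cycle hc (by omega), add_zero, hardWord, if_pos hq] at h0
    have := congrArg (· / b) h0
    simp only [cycleLetter_div hb hy] at this
    exact this.symm
  obtain ⟨c', rfl⟩ := Nat.dvd_of_mod_eq_zero hmod
  rw [mul_comm (k + 1) c'] at *
  have hc' : c' < m := lt_of_mul_lt_mul_right hq (by omega)
  have hlet : ∀ t ≤ k, cycleLetter k b y c t = cycleLetter k b y c' t := fun t ht => by
    rw [← hardWord_cycle hc ht, h t ht, hardWord_cycle hc' ht]
  have hblock : ∀ d < m, d / (2 * b) < b ^ k := fun d hd =>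
    lt_of_lt_of_le (Nat.div_lt_of_lt_mul (by rw [mul_comm, ← hm]; exact hd)) hK
  refine ⟨c', hc', rfl, ?_, ?_⟩
  · refine eq_of_digits_eq (hblock _ hc') (hblock _ hc) fun t ht => ?_
    have := hlet t ht.le
    simp only [cycleLetter, if_pos ht] at this
    omega
  · have := hlet k le_rfl
    simp only [cycleLetter, lt_irrefl, if_false] at this
    omega

/-- Each half of a block has distinct data letters, so a cycle has at most one later copy in its
block. -/
theorem eq_of_cycleData_eq {c c₁ c₂ : ℕ} (hb : 0 < b)
    (hinj : Set.InjOn (y (c / (2 * b))) (Set.Iio b)) (h₁ : c < c₁) (h₂ : c < c₂)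
    (hb₁ : c₁ / (2 * b) = c / (2 * b)) (hb₂ : c₂ / (2 * b) = c / (2 * b))
    (hd₁ : cycleData b y c₁ = cycleData b y c) (hd₂ : cycleData b y c₂ = cycleData b y c) :
    c₁ = c₂ := by
  have e := Nat.div_add_mod c (2 * b)
  have e₁ := Nat.div_add_mod c₁ (2 * b)
  have e₂ := Nat.div_add_mod c₂ (2 * b)
  have l := Nat.mod_lt c (show 0 < 2 * b by omega)
  have l₁ := Nat.mod_lt c₁ (show 0 < 2 * b by omega)
  have l₂ := Nat.mod_lt c₂ (show 0 < 2 * b by omega)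
  unfold cycleData at hd₁ hd₂
  rw [hb₁] at hd₁ e₁
  rw [hb₂] at hd₂ e₂
  generalize c / (2 * b) = r at *
  generalize c % (2 * b) = x at *
  generalize c₁ % (2 * b) = x₁ at *
  generalize c₂ % (2 * b) = x₂ at *
  generalize 2 * b * r = P at *
  have inj : ∀ u v, u < b → v < b → y r u = y r v → u = v := fun u v hu hv h => hinj hu hv h
  split_ifs at hd₁ hd₂ with g1 g2 g3 g4 g5
  all_goals first
    | omega
    | (have := inj _ _ (by omega) (by omega) hd₁; omega)
    | (have := inj _ _ (by omega) (by omega) (hd₁.trans hd₂.symm); omega)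

end Word

/-! ### Repeats and letters of the hard string. -/

section HardString

variable {n k b K L : ℕ} {α : Type} {φ : ℕ → α} {y : ℕ → ℕ → ℕ}

theorem occursAt_iff {w : ℕ → ℕ} (hφ : ∀ u v, φ (w u) = φ (w v) → w u = w v) {i j p : Fin n}
    (hij : i ≤ j) : OccursAt (fun q : Fin n => φ (w q)) i j p ↔
      (p : ℕ) + (j - i) < n ∧ ∀ t ≤ (j : ℕ) - i, w (i + t) = w (p + t) := by
  have hij' : (i : ℕ) ≤ j := hij
  constructor
  · intro h
    have hend := h.end_lt hij
    refine ⟨hend, fun t ht => hφ _ _ ?_⟩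
    have := h t ht
    rw [letterAt_of_lt _ (by omega), letterAt_of_lt _ (by omega)] at this
    exact Option.some.inj this
  · rintro ⟨hend, h⟩ t ht
    rw [letterAt_of_lt _ (by omega), letterAt_of_lt _ (by omega), h t ht]

/-- The next occurrence of a substring longer than two cycles is determined by its first position. -/
theorem hardWord_nextOcc_unique (hk : 0 < k) (hb : 0 < b) (hy : ∀ r x, y r x < b) (hK : K ≤ b ^ k)
    (hL : 2 ≤ L) (hinj : ∀ r < K, Set.InjOn (y r) (Set.Iio b))
    (hφ : ∀ u v, φ (hardWord k b (K * (2 * b)) L y u) = φ (hardWord k b (K * (2 * b)) L y v) →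
      hardWord k b (K * (2 * b)) L y u = hardWord k b (K * (2 * b)) L y v)
    {i j j' p p' : Fin n}
    (h : IsNextOcc (fun q : Fin n => φ (hardWord k b (K * (2 * b)) L y q)) i j p)
    (h' : IsNextOcc (fun q : Fin n => φ (hardWord k b (K * (2 * b)) L y q)) i j' p')
    (hj : (i : ℕ) + 2 * (k + 1) ≤ j) (hj' : (i : ℕ) + 2 * (k + 1) ≤ j') : p = p' := by
  obtain ⟨m, hm⟩ : ∃ m, m = K * (2 * b) := ⟨_, rfl⟩
  rw [← hm] at hφ h h'
  set w := hardWord k b m L y with hw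
  by_cases hi : m * (k + 1) ≤ i
  -- In the tail a letter can recur only as `0`, by truncated subtraction; everything from there on
  -- is `0`, so shifting by one is already an occurrence.
  · have tail : ∀ {j p : Fin n}, IsNextOcc (fun q : Fin n => φ (w q)) i j p → (p : ℕ) = i + 1 := by
      intro j p h
      obtain ⟨hij, hip, hocc, hmin⟩ := h
      have hip' : (i : ℕ) < p := hip
      have hij' : (i : ℕ) ≤ j := hij
      obtain ⟨hend, hocc⟩ := (occursAt_iff hφ hij).1 hocc
      have h0 := hocc 0 (by omega)
      obtain ⟨d, hd⟩ := Nat.exists_eq_add_of_le hi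
      obtain ⟨e, he⟩ := Nat.exists_eq_add_of_le hip'
      have ht : ∀ t, w (m * (k + 1) + t) = L - 1 - t := hardWord_tail
      rw [add_zero, add_zero, he, hd, ht,
        show (m * (k + 1) + d).succ + e = m * (k + 1) + (d + 1 + e) by omega, ht] at h0
      by_contra hne
      refine hmin ⟨i + 1, by omega⟩ (Fin.lt_def.2 (by simp)) (Fin.lt_def.2 (by simp; omega)) ?_
      refine (occursAt_iff hφ hij).2 ⟨by simp; omega, fun t _ => ?_⟩
      simp only
      rw [hd, add_assoc, ht, show m * (k + 1) + d + 1 + t = m * (k + 1) + (d + 1 + t) by omega, ht]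
      omega
    exact Fin.ext ((tail h).trans (tail h').symm)
  · push Not at hi
    obtain ⟨hij, hip, hocc, -⟩ := h
    obtain ⟨hij', hip', hocc', -⟩ := h'
    obtain ⟨-, hocc⟩ := (occursAt_iff hφ hij).1 hocc
    obtain ⟨-, hocc'⟩ := (occursAt_iff hφ hij').1 hocc'
    rw [Fin.lt_def] at hip hip'
    by_cases hi2 : m * (k + 1) < i + (k + 1)
    -- The substring contains the first tail letter `L - 1`, which is positive and does not recur
    -- later in the tail.
    · exfalso
      have h0 := hocc (m * (k + 1) - i) (by omega)
      have ht : ∀ t, w (m * (k + 1) + t) = L - 1 - t := hardWord_tail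
      have e0 := ht 0
      have e1 := ht (p - i)
      rw [show (i : ℕ) + (m * (k + 1) - i) = m * (k + 1) + 0 by omega, e0,
        show (p : ℕ) + (m * (k + 1) - i) = m * (k + 1) + (p - i) by omega, e1] at h0
      omega
    -- The first cycle starting at or after `i`; two cycle lengths leave room for all of it.
    · obtain ⟨c, hc⟩ : ∃ c, c = ((i : ℕ) + k) / (k + 1) := ⟨_, rfl⟩
      have hc1 : c * (k + 1) ≤ i + k := by rw [hc]; exact Nat.div_mul_le_self _ _
      have hc2 : (i : ℕ) + k < c * (k + 1) + (k + 1) := by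
        rw [hc]; exact Nat.lt_div_mul_add (by omega)
      have hcm : c < m := lt_of_mul_lt_mul_right (a := k + 1) (by omega) (by omega)
      have key : ∀ {j p : Fin n}, (i : ℕ) + 2 * (k + 1) ≤ j → (i : ℕ) < p →
          (∀ t ≤ (j : ℕ) - i, w (i + t) = w (p + t)) →
          ∃ c', c < c' ∧ (p : ℕ) + (c * (k + 1) - i) = c' * (k + 1) ∧
            c' / (2 * b) = c / (2 * b) ∧ cycleData b y c' = cycleData b y c := by
        intro j p hj hip hocc
        obtain ⟨c', -, hc', h1, h2⟩ := exists_cycle_of_match (q := p + (c * (k + 1) - i))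
          hk hb hy hK hm hcm fun t ht => by
            have := hocc (c * (k + 1) - i + t) (by omega)
            convert this using 2 <;> omega
        exact ⟨c', lt_of_mul_lt_mul_right (a := k + 1) (by omega) (by omega), hc', h1, h2⟩
      obtain ⟨c₁, h1, h2, h3, h4⟩ := key hj hip hocc
      obtain ⟨c₂, h1', h2', h3', h4'⟩ := key hj' hip' hocc'
      have hcK : c / (2 * b) < K := Nat.div_lt_of_lt_mul (by rw [mul_comm, ← hm]; exact hcm)
      have := eq_of_cycleData_eq hb (hinj _ hcK) h1 h1' h3 h3' h4 h4'
      subst this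
      exact Fin.ext (by omega)

/-- The cycle with data letter `a` in the first half of block `r` occurs again if and only if
`a` is a value of `y r`. -/
theorem hardWord_occursAt_iff (hk : 0 < k) (hb : 0 < b) (hy : ∀ r x, y r x < b) (hK : K ≤ b ^ k)
    (hn : K * (2 * b) * (k + 1) ≤ n)
    (hφ : ∀ u v, φ (hardWord k b (K * (2 * b)) L y u) = φ (hardWord k b (K * (2 * b)) L y v) →
      hardWord k b (K * (2 * b)) L y u = hardWord k b (K * (2 * b)) L y v)
    {r a : ℕ} (hr : r < K) (ha : a < b) {i j : Fin n}
    (hi : (i : ℕ) = (2 * b * r + a) * (k + 1)) (hj : (j : ℕ) = i + k) :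
    (∃ p, i < p ∧ OccursAt (fun q : Fin n => φ (hardWord k b (K * (2 * b)) L y q)) i j p) ↔
      ∃ x < b, y r x = a := by
  obtain ⟨m, hm⟩ : ∃ m, m = K * (2 * b) := ⟨_, rfl⟩
  rw [← hm] at hφ hn ⊢
  have hij : i ≤ j := Fin.le_def.2 (by omega)
  have hblock : ∀ x < 2 * b, 2 * b * r + x < m := fun x hx => by
    rw [hm]; nlinarith
  have hdiv : ∀ x < 2 * b, (2 * b * r + x) / (2 * b) = r := fun x hx => by
    rw [Nat.mul_add_div (by omega), Nat.div_eq_of_lt hx, add_zero]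
  have hmod : ∀ x < 2 * b, (2 * b * r + x) % (2 * b) = x := fun x hx => by
    rw [Nat.mul_add_mod, Nat.mod_eq_of_lt hx]
  have hdata : cycleData b y (2 * b * r + a) = a := by
    rw [cycleData, hmod a (by omega), if_pos ha]
  constructor
  · rintro ⟨p, hip, hocc⟩
    obtain ⟨-, hocc⟩ := (occursAt_iff hφ hij).1 hocc
    rw [Fin.lt_def] at hip
    obtain ⟨c, -, hpc, h1, h2⟩ := exists_cycle_of_match (q := p) hk hb hy hK hm
      (hblock a (by omega)) fun t ht => by
        rw [← hi]; exact hocc t (by omega)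
    have hc : 2 * b * r + a < c := lt_of_mul_lt_mul_right (a := k + 1) (by omega) (by omega)
    rw [hdiv a (by omega)] at h1
    rw [hdata, cycleData, h1] at h2
    have e := Nat.div_add_mod c (2 * b)
    have l := Nat.mod_lt c (show 0 < 2 * b by omega)
    rw [h1] at e
    split_ifs at h2
    · omega
    · exact ⟨_, by omega, h2⟩
  · rintro ⟨x, hx, hxa⟩
    have hc' := hblock (b + x) (by omega)
    have hlt : (2 * b * r + (b + x)) * (k + 1) + k < m * (k + 1) := by nlinarith
    have hlt' : (2 * b * r + a) * (k + 1) < (2 * b * r + (b + x)) * (k + 1) :=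
      Nat.mul_lt_mul_of_pos_right (by omega) (by omega)
    refine ⟨⟨(2 * b * r + (b + x)) * (k + 1), by omega⟩, Fin.lt_def.2 (by simp only; omega),
      (occursAt_iff hφ hij).2 ⟨by simp only; omega, fun t ht => ?_⟩⟩
    have ht' : t ≤ k := by omega
    simp only
    rw [hi, hardWord_cycle (hblock a (by omega)) ht', hardWord_cycle hc' ht', cycleLetter,
      cycleLetter, hdata, hdiv a (by omega), hdiv (b + x) (by omega), cycleData,
      hmod (b + x) (by omega), if_neg (show ¬b + x < b by omega), hdiv (b + x) (by omega),
      Nat.add_sub_cancel_left, hxa]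

theorem hardWord_max (k b m L : ℕ) (y y' : ℕ → ℕ → ℕ) (q : ℕ) :
    hardWord k b m L (fun r x => max (y r x) (y' r x)) q =
      max (hardWord k b m L y q) (hardWord k b m L y' q) := by
  have hd : ∀ c, cycleData b (fun r x => max (y r x) (y' r x)) c =
      max (cycleData b y c) (cycleData b y' c) := fun c => by
    unfold cycleData; split_ifs <;> simp
  unfold hardWord cycleLetter
  split_ifs <;> simp [hd]

/-- The tail alone supplies these letters, whatever `y` is; thus pointwise maxima are admissible
inputs too. -/
theorem le_numLetters {m : ℕ} (hn : m * (k + 1) + L ≤ n) (hφ : Set.InjOn φ (Set.Iio L)) :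
    L ≤ numLetters (fun q : Fin n => φ (hardWord k b m L y q)) := by
  have hsub : φ '' Set.Iio L ⊆ Set.range fun q : Fin n => φ (hardWord k b m L y q) := by
    rintro _ ⟨v, hv, rfl⟩
    have hv' : v < L := hv
    refine ⟨⟨m * (k + 1) + (L - 1 - v), by omega⟩, ?_⟩
    simp only [hardWord_tail]
    congr 1
    omega
  calc L = (φ '' Set.Iio L).ncard := by
        rw [hφ.ncard_image, ← Finset.coe_Iio, Set.ncard_coe_finset, Nat.card_Iio]
    _ ≤ _ := Set.ncard_le_ncard hsub (Set.finite_range _)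

end HardString

/-! ### Counting traces and choosing parameters. -/

section LowerBound

variable {n k b K L : ℕ} {α : Type}

/-- Monotonicity on all of `ℕ`, obtained by clamping, lets the encoding commute with `max`. -/
theorem exists_letters (α : Type) [LinearOrder α] [Fintype α] (h : 0 < Fintype.card α) :
    ∃ φ : ℕ → α, Monotone φ ∧ Set.InjOn φ (Set.Iio (Fintype.card α)) := by
  let e := Fintype.orderIsoFinOfCardEq α rfl
  refine ⟨fun v => e ⟨min v (Fintype.card α - 1), by omega⟩, fun u v huv => ?_, fun u hu v hv huv => ?_⟩
  · refine e.monotone (Fin.le_def.2 ?_)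
    simp only
    omega
  · have := congrArg Fin.val (e.injective huv)
    simp only [Set.mem_Iio] at this hu hv
    omega

/-- The family of permutations, as a function on natural numbers. -/
def permData (π : Fin K → Equiv.Perm (Fin b)) (r x : ℕ) : ℕ :=
  if h : r < K ∧ x < b then π ⟨r, h.1⟩ ⟨x, h.2⟩ else 0

theorem permData_of_lt (π : Fin K → Equiv.Perm (Fin b)) {r x : ℕ} (hr : r < K) (hx : x < b) :
    permData π r x = π ⟨r, hr⟩ ⟨x, hx⟩ := dif_pos ⟨hr, hx⟩

theorem permData_lt (hb : 0 < b) (π : Fin K → Equiv.Perm (Fin b)) (r x : ℕ) :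
    permData π r x < b := by
  unfold permData
  split_ifs
  · exact Fin.is_lt _
  · exact hb

/-- If the pointwise maximum of two permutations is onto, then they are equal. -/
theorem perm_eq_of_max_surjective (σ τ : Equiv.Perm (Fin b))
    (h : Function.Surjective fun x => max (σ x) (τ x)) : σ = τ := by
  have hbij : Function.Bijective fun x => max (σ x) (τ x) := Finite.surjective_iff_bijective.1 h
  -- A permutation and the bijective maximum have equal sums of values, so pointwise domination is
  -- equality.
  have hsum : ∀ ρ : Equiv.Perm (Fin b), (∀ x, ρ x ≤ max (σ x) (τ x)) →
      ∀ x, ρ x = max (σ x) (τ x) := by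
    intro ρ hρ x
    have e : ∑ x, (ρ x : ℕ) = ∑ x, ((max (σ x) (τ x) : Fin b) : ℕ) :=
      (Equiv.sum_comp ρ fun z : Fin b => (z : ℕ)).trans (hbij.sum_comp fun z : Fin b => (z : ℕ)).symm
    exact Fin.ext ((Finset.sum_eq_sum_iff_of_le fun x _ => Fin.le_def.1 (hρ x)).1 e x
      (Finset.mem_univ x))
  ext x
  exact congrArg Fin.val ((hsum σ (fun x => le_max_left _ _) x).trans
    (hsum τ (fun x => le_max_right _ _) x).symm)

theorem exists_hard_string [LinearOrder α] [Fintype α] (hk : 0 < k) (hb : 0 < b)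
    (hK : K ≤ b ^ k) (hL : 2 ≤ L) (hLα : L ≤ Fintype.card α) (hbα : (k + 1) * b ≤ Fintype.card α)
    (hn : K * (2 * b) * (k + 1) + L ≤ n) (A : Algorithm n)
    (hA : ∀ s : Fin n → α, L ≤ numLetters s → ∃ κ t : ℕ, A.ComputesWith s κ t) :
    ∃ s : Fin n → α, L ≤ numLetters s ∧ (closedRepeats s).card ≤ n * (2 * (k + 1) + 1) ∧
      ∃ κ t : ℕ, A.ComputesWith s κ t ∧ b.factorial ^ K ≤ 3 ^ (κ + 1) := by
  obtain ⟨φ, hmono, hinj⟩ := exists_letters α (by omega)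
  have hφL : Set.InjOn φ (Set.Iio L) := hinj.mono (Set.Iio_subset_Iio hLα)
  have hφ : ∀ y : ℕ → ℕ → ℕ, (∀ r x, y r x < b) → ∀ u v,
      φ (hardWord k b (K * (2 * b)) L y u) = φ (hardWord k b (K * (2 * b)) L y v) →
      hardWord k b (K * (2 * b)) L y u = hardWord k b (K * (2 * b)) L y v :=
    fun y hy u v h => hinj (hardWord_lt hb hy hbα hLα u) (hardWord_lt hb hy hbα hLα v) h
  let S : (ℕ → ℕ → ℕ) → Fin n → α := fun y q => φ (hardWord k b (K * (2 * b)) L y q)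
  have hS : ∀ y, L ≤ numLetters (S y) := fun y => le_numLetters hn hφL
  -- All `y` are needed, not only permutations: correctness is used on the maximum of two families.
  choose κ t hcomp using fun y => hA (S y) (hS y)
  choose w hwlen htrace using fun y => (hcomp y).exists_trace
  have hw : Function.Injective fun π : Fin K → Equiv.Perm (Fin b) => w (permData π) := by
    intro π π' hππ
    simp only at hππ
    have htr := (htrace (permData π)).max (hππ ▸ htrace (permData π'))
    let z : ℕ → ℕ → ℕ := fun r x => max (permData π r x) (permData π' r x)
    have hz : ∀ r x, z r x < b := fun r x => max_lt (permData_lt hb π r x) (permData_lt hb π' r x)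
    have hSz : (fun i => max (S (permData π) i) (S (permData π') i)) = S z := by
      funext i
      simp only [S, z, hardWord_max, hmono.map_max]
    rw [hSz] at htr
    have hout : closedRepeats (S (permData π)) = closedRepeats (S z) := htr.out_eq (hcomp z)
    funext r
    refine perm_eq_of_max_surjective _ _ fun a => ?_
    have hlt : (2 * b * r + a) * (k + 1) + k < n := by
      have h1 : 2 * b * r + a < K * (2 * b) := by nlinarith [r.2, a.2]
      have h2 : (2 * b * r + a) * (k + 1) + k < K * (2 * b) * (k + 1) := by nlinarith
      omega
    let i : Fin n := ⟨(2 * b * r + a) * (k + 1), by omega⟩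
    let j : Fin n := ⟨(2 * b * r + a) * (k + 1) + k, hlt⟩
    have hij : i ≤ j := Fin.le_def.2 (by simp [i, j])
    have hπ := (hardWord_occursAt_iff hk hb (permData_lt hb π) hK (by omega)
      (hφ _ (permData_lt hb π)) r.2 a.2 (i := i) (j := j) rfl rfl).2 (by
        refine ⟨(π r).symm a, Fin.is_lt _, ?_⟩
        rw [permData_of_lt π r.2 (Fin.is_lt _)]
        simp)
    rw [← exists_isClosedRepeat_iff hij] at hπ
    have hmem : ∀ i' j', IsClosedRepeat (S (permData π)) i' j' ↔ IsClosedRepeat (S z) i' j' := by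
      intro i' j'
      have := congrArg (fun F => (i', j') ∈ F) hout
      simpa [closedRepeats] using this
    have hzc : ∃ i' j', i' ≤ i ∧ j ≤ j' ∧ IsClosedRepeat (S z) i' j' := by
      obtain ⟨i', j', h1, h2, h3⟩ := hπ
      exact ⟨i', j', h1, h2, (hmem i' j').1 h3⟩
    rw [exists_isClosedRepeat_iff hij] at hzc
    obtain ⟨x, hx, hxa⟩ := (hardWord_occursAt_iff hk hb hz hK (by omega) (hφ _ hz) r.2 a.2
      (i := i) (j := j) rfl rfl).1 hzc
    refine ⟨⟨x, hx⟩, Fin.ext ?_⟩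
    rw [← hxa]
    simp only [z, permData_of_lt _ r.2 hx]
    exact Fin.val_strictMono.monotone.map_max
  obtain ⟨π, hπ⟩ := exists_card_le_three_pow _ hw
  refine ⟨S (permData π), hS _, ?_, κ (permData π), t (permData π), hcomp _, ?_⟩
  · refine card_closedRepeats_le _ fun i j j' p p' h h' hj hj' =>
      hardWord_nextOcc_unique hk hb (permData_lt hb π) hK hL ?_ (hφ _ (permData_lt hb π)) h h' hj hj'
    intro r hr x hx x' hx' hxx
    rw [permData_of_lt π hr hx, permData_of_lt π hr hx'] at hxx
    exact congrArg Fin.val ((π ⟨r, hr⟩).injective (Fin.ext hxx))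
  · rw [hwlen] at hπ
    simpa [Fintype.card_perm] using hπ

/-- At least half of the factors of `b!` are at least `b / 2 + 1`, which is at least the square root
of `b`. -/
theorem mul_log_le_log_factorial (hb : 4 ≤ b) :
    (b : ℝ) * Real.log b / 4 ≤ Real.log b.factorial := by
  have h1 : (b / 2 + 1) ^ (b - b / 2) ≤ b.factorial := by
    have h := Nat.factorial_mul_pow_le_factorial (m := b / 2) (n := b - b / 2)
    rw [Nat.add_sub_cancel' (Nat.div_le_self b 2)] at h
    exact (Nat.le_mul_of_pos_left _ (Nat.factorial_pos _)).trans h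
  have h2 : (b : ℝ) ≤ ((b / 2 + 1 : ℕ) : ℝ) ^ 2 := by
    have : b ≤ (b / 2 + 1) ^ 2 := by
      have : b < 2 * (b / 2 + 1) := by omega
      nlinarith
    exact_mod_cast this
  have hb0 : (0 : ℝ) < b := by exact_mod_cast (by omega : 0 < b)
  have h3 : Real.log b ≤ 2 * Real.log ((b / 2 + 1 : ℕ) : ℝ) := by
    have := Real.log_le_log hb0 h2
    rwa [Real.log_pow] at this
  have h4 : ((b - b / 2 : ℕ) : ℝ) * Real.log ((b / 2 + 1 : ℕ) : ℝ) ≤ Real.log b.factorial := by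
    rw [← Real.log_pow]
    exact Real.log_le_log (by positivity) (by exact_mod_cast h1)
  have h5 : (b : ℝ) / 2 ≤ ((b - b / 2 : ℕ) : ℝ) := by
    have : b ≤ 2 * (b - b / 2) := by omega
    have : (b : ℝ) ≤ 2 * ((b - b / 2 : ℕ) : ℝ) := by exact_mod_cast this
    linarith
  have h6 : 0 ≤ Real.log b := Real.log_nonneg (by exact_mod_cast (by omega : 1 ≤ b))
  nlinarith

open Filter in
/-- Parameters of the hard strings: `b` is about `n ^ (1 / k)`. -/
theorem exists_parameters {ε : ℝ} (hε : 0 < ε) : ∃ k : ℕ, 0 < k ∧ ∃ n₀ : ℕ, ∀ n : ℕ, n₀ ≤ n →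
    ∃ b : ℕ, 4 ≤ b ∧ n ≤ b ^ k ∧ ((k + 1) * b : ℝ) ≤ (n : ℝ) ^ ε ∧ 8 * b * (k + 1) ≤ n ∧
      128 * ((k : ℝ) + 1) * k ≤ n * Real.log n ∧ 4 ≤ n ∧ (2 : ℝ) ≤ (n : ℝ) ^ ε := by
  -- With `x = n ^ (1 / k)`, the bound `2 / ε` gives `x * x ≤ n ^ ε`, so the letters fit the
  -- alphabet; the bound `2` gives `x * x ≤ n`, so two blocks of twice the needed length and more
  -- fit in the string.
  obtain ⟨k, hk⟩ := exists_nat_ge (max (2 / ε) 2)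
  have hk1 : 2 / ε ≤ k := (le_max_left _ _).trans hk
  have hk2 : (2 : ℝ) ≤ k := (le_max_right _ _).trans hk
  have hk0 : 0 < k := by
    have : (0 : ℝ) < k := by linarith
    exact_mod_cast this
  have hδ : 0 < 1 / (k : ℝ) := by positivity
  have hδε : 1 / (k : ℝ) + 1 / k ≤ ε := by
    rw [div_le_iff₀ hε] at hk1
    rw [← add_div, div_le_iff₀ (by positivity)]
    linarith
  have hδ1 : 1 / (k : ℝ) + 1 / k ≤ 1 := by
    rw [← add_div, div_le_iff₀ (by positivity)]
    linarith
  have hpow : Tendsto (fun n : ℕ => (n : ℝ) ^ (1 / (k : ℝ))) atTop atTop :=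
    (tendsto_rpow_atTop hδ).comp tendsto_natCast_atTop_atTop
  have hlog : Tendsto (fun n : ℕ => (n : ℝ) * Real.log n) atTop atTop :=
    (tendsto_natCast_atTop_atTop).atTop_mul_atTop₀
      (Real.tendsto_log_atTop.comp tendsto_natCast_atTop_atTop)
  obtain ⟨n₀, hn₀⟩ := eventually_atTop.1 ((hpow.eventually_ge_atTop (16 * ((k : ℝ) + 1))).and
    ((hlog.eventually_ge_atTop (128 * ((k : ℝ) + 1) * k)).and (eventually_ge_atTop 4)))
  refine ⟨k, hk0, n₀, fun n hn => ?_⟩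
  obtain ⟨h1, h2, h3⟩ := hn₀ n hn
  have hn1 : (1 : ℝ) ≤ n := by exact_mod_cast (by omega : 1 ≤ n)
  set x := (n : ℝ) ^ (1 / (k : ℝ)) with hx
  have hx2 : x * x = (n : ℝ) ^ (1 / (k : ℝ) + 1 / k) := by
    rw [Real.rpow_add (by linarith)]
  have hxε : x * x ≤ (n : ℝ) ^ ε := hx2 ▸ Real.rpow_le_rpow_of_exponent_le hn1 hδε
  have hx1 : x * x ≤ n := by
    rw [hx2]
    simpa using Real.rpow_le_rpow_of_exponent_le hn1 hδ1
  have hxk : x ^ k = n := by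
    rw [hx, one_div, Real.rpow_inv_natCast_pow (by linarith) hk0.ne']
  have hb1 : x ≤ ⌈x⌉₊ := Nat.le_ceil x
  have hb2 : (⌈x⌉₊ : ℝ) < x + 1 := Nat.ceil_lt_add_one (by linarith)
  refine ⟨⌈x⌉₊, ?_, ?_, ?_, ?_, h2, h3, ?_⟩
  · have : (4 : ℝ) ≤ ⌈x⌉₊ := by linarith
    exact_mod_cast this
  · have : (n : ℝ) ≤ (⌈x⌉₊ : ℝ) ^ k := hxk ▸ pow_le_pow_left₀ (by linarith) hb1 k
    exact_mod_cast this
  · nlinarith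
  · have : 8 * (⌈x⌉₊ : ℝ) * (k + 1) ≤ n := by nlinarith
    exact_mod_cast this
  · nlinarith

end LowerBound
end ClosedRepeats

/-! ### Assembly of the constants. -/

open ClosedRepeats in
theorem theorem3 (ε : ℝ) (hε : 0 < ε) :
    ∃ c : ℝ, 0 < c ∧ ∃ C : ℝ, 0 < C ∧ ∃ n₀ : ℕ, ∀ n : ℕ, n₀ ≤ n →
      ∀ (α : Type) [LinearOrder α] [Fintype α], (n : ℝ) ^ ε ≤ (Fintype.card α : ℝ) →
        ∀ A : ClosedRepeats.Algorithm n,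
          (∀ s : Fin n → α, min (Fintype.card α) (n / 2) ≤ ClosedRepeats.numLetters s →
            ∃ k t : ℕ, A.ComputesWith s k t) →
          ∃ s : Fin n → α, min (Fintype.card α) (n / 2) ≤ ClosedRepeats.numLetters s ∧
            ((ClosedRepeats.closedRepeats s).card : ℝ) ≤ C * n ∧
            ∃ k t : ℕ, A.ComputesWith s k t ∧
              c * (n * Real.logb 2 n) ≤ (k : ℝ) ∧ k ≤ t := by
  obtain ⟨k, hk, n₀, hpar⟩ := exists_parameters hε
  -- Here `256 = 64 * 2 * 2`: `64` comes from `h1`, one factor `2` from passing to base-two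
  -- logarithms, the other from absorbing the `+ 1` in `κ + 1` by `hlogn`.
  refine ⟨1 / (256 * ((k : ℝ) + 1) * k), by positivity, 2 * ((k : ℝ) + 1) + 1, by positivity, n₀,
    fun n hn α _ _ hα A hA => ?_⟩
  obtain ⟨b, hb, hnb, hbε, hbn, hlogn, hn4, h2⟩ := hpar n hn
  have hbα : (k + 1) * b ≤ Fintype.card α := by
    have := hbε.trans hα
    exact_mod_cast this
  have hα2 : 2 ≤ Fintype.card α := by
    have := h2.trans hα
    exact_mod_cast this
  -- Twice the length of a block, so `n / P` blocks fill at most half of the string and leave room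
  -- for the tail.
  set P := 4 * (b * (k + 1)) with hP
  have hP0 : 0 < P := by positivity
  have hKn : P * (n / P) ≤ n := Nat.mul_div_le n P
  obtain ⟨s, hs, hcard, κ, t, hcomp, hfac⟩ := exists_hard_string (K := n / P) hk (by omega)
    ((Nat.div_le_self n P).trans hnb) (L := min (Fintype.card α) (n / 2)) (by omega)
    (min_le_left _ _) hbα (by
      have : 2 * (n / P * (2 * b) * (k + 1)) = P * (n / P) := by rw [hP]; ring
      omega) A hA
  refine ⟨s, hs, ?_, κ, t, hcomp, ?_, hcomp.comparisons_le_time⟩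
  · have : ((closedRepeats s).card : ℝ) ≤ ((n * (2 * (k + 1) + 1) : ℕ) : ℝ) := by
      exact_mod_cast hcard
    refine this.trans (le_of_eq ?_)
    push_cast
    ring
  · have hb0 : (0 : ℝ) < b := by exact_mod_cast (by omega : 0 < b)
    have hn0 : (0 : ℝ) < n := by exact_mod_cast (by omega : 0 < n)
    have hk0 : (0 : ℝ) < k := by exact_mod_cast hk
    -- Since `n / P` is at least `1`, rounding down loses at most a factor of two.
    have hKlow : (n : ℝ) ≤ 8 * b * (k + 1) * (n / P : ℕ) := by
      have h1 : n < P * (n / P) + P := Nat.lt_mul_div_succ n hP0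
      have h3 : 1 ≤ n / P := (Nat.one_le_div_iff hP0).2 (by rw [hP]; linarith)
      have : n ≤ 8 * b * (k + 1) * (n / P) := by
        have : 8 * b * (k + 1) * (n / P) = P * (n / P) + P * (n / P) := by rw [hP]; ring
        nlinarith
      exact_mod_cast this
    have hlogfac : (n / P : ℕ) * Real.log b.factorial ≤ (κ + 1) * Real.log 3 := by
      have : ((b.factorial : ℝ)) ^ (n / P) ≤ 3 ^ (κ + 1) := by exact_mod_cast hfac
      have := Real.log_le_log (by positivity) this
      rw [Real.log_pow, Real.log_pow] at this
      exact_mod_cast this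
    have hlogb : Real.log n ≤ k * Real.log b := by
      rw [← Real.log_pow]
      exact Real.log_le_log hn0 (by exact_mod_cast hnb)
    have hfac' := mul_log_le_log_factorial hb
    have hlog3 : Real.log 3 ≤ 2 := by
      have := Real.log_le_sub_one_of_pos (show (0 : ℝ) < 3 by norm_num)
      linarith
    have hlog2 : (1 : ℝ) / 2 ≤ Real.log 2 := by linarith [Real.log_two_gt_d9]
    have hlogn0 : 0 ≤ Real.log n := Real.log_natCast_nonneg n
    have h1 : (n : ℝ) * Real.log n ≤ 64 * (k + 1) * k * (κ + 1) := by
      calc (n : ℝ) * Real.log n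
          ≤ (8 * b * (k + 1) * (n / P : ℕ)) * (k * Real.log b) :=
            mul_le_mul hKlow hlogb hlogn0 (by positivity)
        _ = 32 * (k + 1) * k * ((n / P : ℕ) * (b * Real.log b / 4)) := by ring
        _ ≤ 32 * (k + 1) * k * ((κ + 1) * 2) := by
            refine mul_le_mul_of_nonneg_left ?_ (by positivity)
            refine (mul_le_mul_of_nonneg_left hfac' (by positivity)).trans (hlogfac.trans ?_)
            exact mul_le_mul_of_nonneg_left hlog3 (by positivity)
        _ = 64 * (k + 1) * k * (κ + 1) := by ring
    have h2 : Real.logb 2 n ≤ 2 * Real.log n := by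
      rw [Real.logb, div_le_iff₀ (by linarith)]
      nlinarith
    have h3 : (n : ℝ) * Real.logb 2 n ≤ 2 * (n * Real.log n) := by nlinarith
    rw [one_div, inv_mul_le_iff₀ (by positivity)]
    nlinarith
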